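/- Let $X$ be a finite 2-dimensional simplicial complex: the path connected quotient of finitely many topological triangles by gluing homeomorphisms between edges of these triangles, where there is at most one gluing map for each ordered pair of edges, the only gluing map from an edge to itself is the identity, and the gluing maps are closed under inverses and under composition whenever defined. Let $S$ be its set of vertices. For $r>0$ let $r\tilde T=\{z\in\mathbb H^2: 0\le \mathrm{Re}\,z\le r,\ |z-\tfrac r2|\ge \tfrac r2\}$ be the ideal triangle with vertices $0,r,\infty$ in the upper half-plane. Let $\sigma$ be a complete ideal hyperbolic metric on $X\setminus S$: every triangle minus its vertices is identified with the standard ideal triangle $\tilde T$ by a homeomorphism and carries the hyperbolic metric pulled back from $\tilde T$, the gluing maps are isometries between the edges, and the induced length metric on $X\setminus S$ is complete. Let $e$ be an edge of $X$, let $e_1,\dots,e_n$ be the edges of triangles that are mapped to $e$, and let $T_j$ be the triangle with edge $e_j$ (a triangle occurs once for each of its edges mapped to $e$). Let $\{\phi_j:T_j\setminus S\to r_j\tilde T\}_{j=1}^n$ be a local model for $e$: each $\phi_j$ is an isometry onto $r_j\tilde T$, it maps $e_j$ onto the geodesic joining $0$ and $\infty$, $\phi_j|_{e_j}=\phi_k\circ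 f$ for every gluing map $f:e_j\to e_k$, and $\max_j r_j=1$. Let $Y$ be the union of the half-triangles $$H_j=\phi_j^{-1}\{z\in r_j\tilde T : \mathrm{Re}\, z<\tfrac{r_j}{2}\},\qquad j=1,\dots,n,$$ joined to each other along $e$; that is, $Y$ is the quotient of the disjoint union $\coprod_j H_j$ by the identifications $x\sim f(x)$ for the gluing maps $f:e_j\to e_k$. Then the length distance induced by $\sigma$ on $Y$ (the infimum of the $\sigma$-lengths of paths in $Y$) is a metric, and with it $Y$ is a CAT$(-1)$ space: any two points of $Y$ are joined by a geodesic, and for all $P,Q,R,Q_t\in Y$ and $t\in[0,1]$ with $d(Q,Q_t)=t\,d(Q,R)$ and $d(Q_t,R)=(1-t)\,d(Q,R)$, $$\sinh(d(Q,R))\cosh(d(P,Q_t))\le \sinh((1-t)d(Q,R))\cosh(d(P,Q))+\sinh(t\,d(Q,R))\cosh(d(P,R)).$$ -/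

import Mathlib

open scoped UpperHalfPlane ENNReal

universe u

/-! ### Length distances of glued spaces -/

/-- The infimum, over all finite chains `p = u 0, u 1, …, u n = q`, of the total cost of the
chain (the chain with `n = 0` is allowed when `p = q`). -/
noncomputable def chainEDist {Y : Type*} (c : Y → Y → ℝ≥0∞) (p q : Y) : ℝ≥0∞ :=
  ⨅ (n : ℕ) (w : ℕ → Y) (_ : w 0 = p ∧ w n = q), ∑ k ∈ Finset.range n, c (w k) (w (k + 1))

/-- Distance in a space `Y` assembled from pieces `P i`, each with its own distance `d i`,
through maps `π i : P i → Y`: the infimum of the lengths of the broken paths whose successive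
segments each lie in one piece, a segment from `x` to `x'` in `P i` having length `d i x x'`.
If every `P i` is a geodesic space this is the infimum of the lengths of paths in `Y`. It is
`∞` if no such path exists. -/
noncomputable def gluedEDist {ι : Type*} {P : ι → Type*} {Y : Type*} (π : ∀ i, P i → Y)
    (d : ∀ i, P i → P i → ℝ≥0∞) : Y → Y → ℝ≥0∞ :=
  chainEDist fun y y' =>
    ⨅ (i : ι) (x : P i) (x' : P i) (_ : π i x = y ∧ π i x' = y'), d i x x'

/-! ### CAT(-1) spaces -/

/-- A CAT(-1) space: a metric space in which any two points are joined by a geodesic, and in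
which every geodesic triangle satisfies the hyperbolic comparison inequality. Here `M` is the
point `Q_t` on a geodesic from `Q` to `R`. The inequality has been multiplied by
`sinh (dist Q R)`, so that it makes sense also for `Q = R`. Metric completeness is not
part of the notion. -/
structure IsCATNegOne (Y : Type*) [MetricSpace Y] : Prop where
  exists_geodesic : ∀ P Q : Y, ∃ γ : ℝ → Y, γ 0 = P ∧ γ (dist P Q) = Q ∧
    ∀ s ∈ Set.Icc 0 (dist P Q), ∀ t ∈ Set.Icc 0 (dist P Q), dist (γ s) (γ t) = |s - t|
  comparison : ∀ P Q R M : Y, ∀ t ∈ Set.Icc (0 : ℝ) 1,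
    dist Q M = t * dist Q R → dist M R = (1 - t) * dist Q R →
    Real.sinh (dist Q R) * Real.cosh (dist P M) ≤
      Real.sinh ((1 - t) * dist Q R) * Real.cosh (dist P Q) +
        Real.sinh (t * dist Q R) * Real.cosh (dist P R)

/-! ### Finite 2-dimensional simplicial complexes -/

/-- A finite family of topological triangles: each `T i` comes with a homeomorphism to the
standard 2-simplex, written in barycentric coordinates. -/
structure TriangleFamily where
  C : Type u
  finite_C : Finite C
  T : C → Type u
  [top : ∀ i, TopologicalSpace (T i)]
  param : ∀ i, T i ≃ₜ stdSimplex ℝ (Fin 3)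

attribute [instance] TriangleFamily.top

namespace TriangleFamily

/-- Barycentric coordinates on a triangle. -/
def coord (F : TriangleFamily.{u}) {i : F.C} (x : F.T i) (k : Fin 3) : ℝ :=
  (F.param i x : Fin 3 → ℝ) k

/-- The pair `(i, k)` names the edge of the triangle `T i` opposite to its `k`-th vertex. -/
abbrev TEdge (F : TriangleFamily.{u}) : Type u := F.C × Fin 3

/-- The closed edge named by `a`, a subset of the triangle `T a.1`. -/
def side (F : TriangleFamily.{u}) (a : F.TEdge) : Set (F.T a.1) :=
  {x | F.coord x a.2 = 0}

/-- A point of a triangle is a vertex if one of its barycentric coordinates is `1`. -/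
def IsVertex (F : TriangleFamily.{u}) {i : F.C} (x : F.T i) : Prop :=
  ∃ k, F.coord x k = 1

/-- A triangle with its three vertices removed. -/
abbrev Face (F : TriangleFamily.{u}) (i : F.C) : Type u :=
  {x : F.T i // ¬ F.IsVertex x}

end TriangleFamily

/-- A family of triangles with gluing homeomorphisms between their edges: at most one for each
ordered pair of edges, containing the identities and closed under inverses and composition. -/
structure TriangleGluing extends TriangleFamily.{u} where
  glue : ∀ a b : toTriangleFamily.TEdge,
    Set (toTriangleFamily.side a ≃ₜ toTriangleFamily.side b)
  glue_subsingleton : ∀ a b, (glue a b).Subsingleton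
  glue_refl : ∀ a, Homeomorph.refl _ ∈ glue a a
  glue_symm : ∀ a b, ∀ f ∈ glue a b, f.symm ∈ glue b a
  glue_trans : ∀ a b c, ∀ f ∈ glue a b, ∀ g ∈ glue b c, f.trans g ∈ glue a c

namespace TriangleGluing

/-- `x` lies on the edge `a` and the gluing map `a → b` sends it to `x'`. -/
def Glued (G : TriangleGluing.{u}) (a b : G.TEdge) (x : G.T a.1) (x' : G.T b.1) : Prop :=
  ∃ f ∈ G.glue a b, ∃ h : x ∈ G.side a, ((f ⟨x, h⟩ : G.side b) : G.T b.1) = x'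

/-- The identifications made by the gluing maps on the disjoint union of the triangles. -/
inductive Ident (G : TriangleGluing.{u}) : (Σ i, G.T i) → (Σ i, G.T i) → Prop
  | glued (a b : G.TEdge) (x : G.T a.1) (x' : G.T b.1) (h : G.Glued a b x x') :
      Ident G ⟨a.1, x⟩ ⟨b.1, x'⟩

/-- The space obtained from the disjoint union of the triangles by the gluing maps, with the
quotient topology. -/
abbrev Space (G : TriangleGluing.{u}) : Type u := Quot G.Ident

/-- The quotient map, restricted to one triangle. -/
def proj (G : TriangleGluing.{u}) {i : G.C} (x : G.T i) : G.Space := Quot.mk _ ⟨i, x⟩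

/-- The set of vertices of the space. -/
def vertexSet (G : TriangleGluing.{u}) : Set G.Space :=
  {p | ∃ (i : G.C) (x : G.T i), G.IsVertex x ∧ G.proj x = p}

/-- Two edges of triangles have the same image in the space if there is a gluing map between
them. -/
def edgeSetoid (G : TriangleGluing.{u}) : Setoid G.TEdge where
  r a b := (G.glue a b).Nonempty
  iseqv :=
    { refl := fun a => ⟨_, G.glue_refl a⟩
      symm := fun {a b} ⟨f, hf⟩ => ⟨_, G.glue_symm a b f hf⟩
      trans := fun {a b c} ⟨f, hf⟩ ⟨g, hg⟩ => ⟨_, G.glue_trans a b c f hf g hg⟩ }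

/-- The edges of the space. -/
abbrev Edge (G : TriangleGluing.{u}) : Type u := Quotient G.edgeSetoid

/-- The edges of triangles that are mapped onto a given edge of the space. -/
abbrev Over (G : TriangleGluing.{u}) (e : G.Edge) : Type u :=
  {a : G.TEdge // (Quotient.mk G.edgeSetoid a : G.Edge) = e}

end TriangleGluing

/-- A finite 2-dimensional simplicial complex. -/
structure TriangleComplex extends TriangleGluing.{u} where
  pathConnected : PathConnectedSpace toTriangleGluing.Space

/-! ### Ideal hyperbolic metrics -/

/-- The ideal triangle with ideal vertices `0`, `r`, `∞` in the upper half-plane (for `r > 0`):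
the points between the vertical geodesics over `0` and `r` and not below the geodesic from `0`
to `r`. It carries the hyperbolic distance of `ℍ`. -/
def idealTriangle (r : ℝ) : Set ℍ :=
  {z | 0 ≤ z.re ∧ z.re ≤ r ∧ (r / 2) ^ 2 ≤ (z.re - r / 2) ^ 2 + z.im ^ 2}

/-- An ideal hyperbolic metric on the complex with its vertices removed: charts from the
triangles without vertices to the standard ideal triangle, such that the gluing maps are
isometries for the distances pulled back by the charts. (A homeomorphism as in `chart`
automatically carries the three open edges to the three boundary geodesics.) -/
structure IdealHyperbolicMetric (X : TriangleComplex.{u}) where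
  chart : ∀ i : X.C, X.Face i ≃ₜ idealTriangle 1
  glue_isometry : ∀ (a b : X.TEdge) (x y : X.Face a.1) (x' y' : X.Face b.1),
    X.Glued a b x x' → X.Glued a b y y' →
      dist (chart b.1 x') (chart b.1 y') = dist (chart a.1 x) (chart a.1 y)

namespace IdealHyperbolicMetric

variable {X : TriangleComplex.{u}}

/-- The hyperbolic distance on a triangle without vertices, pulled back by the chart. -/
noncomputable def faceDist (σ : IdealHyperbolicMetric X) (i : X.C) (x y : X.Face i) : ℝ :=
  dist (σ.chart i x) (σ.chart i y)

/-- The distance on the complex without its vertices: the infimum of the lengths of paths,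
measured in the faces. -/
noncomputable def spaceEDist (σ : IdealHyperbolicMetric X) : X.Space → X.Space → ℝ≥0∞ :=
  gluedEDist (fun (i : X.C) (x : X.Face i) => X.proj x.1)
    (fun i x y => ENNReal.ofReal (σ.faceDist i x y))

/-- The complex without its vertices is complete: every Cauchy sequence converges. -/
def IsComplete (σ : IdealHyperbolicMetric X) : Prop :=
  ∀ w : ℕ → X.Space, (∀ n, w n ∉ X.vertexSet) →
    (∀ ε > 0, ∃ N, ∀ m ≥ N, ∀ n ≥ N, σ.spaceEDist (w m) (w n) < ε) →
      ∃ p, p ∉ X.vertexSet ∧ ∀ ε > 0, ∃ N, ∀ n ≥ N, σ.spaceEDist (w n) p < ε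

/-- A local model for the edge `e`: for each edge `e_j` of a triangle `T_j` lying over `e`, an
isometry from `T_j` without its vertices onto the ideal triangle `0`, `r_j`, `∞`, carrying `e_j`
onto the geodesic from `0` to `∞`, compatible with the gluing maps, with largest `r_j` equal
to `1`. A triangle occurs once for each of its edges lying over `e`. -/
structure LocalModel (σ : IdealHyperbolicMetric X) (e : X.Edge) where
  r : X.Over e → ℝ
  r_pos : ∀ j, 0 < r j
  φ : ∀ j : X.Over e, X.Face j.1.1 ≃ idealTriangle (r j)
  φ_isometry : ∀ j x y, dist (φ j x) (φ j y) = σ.faceDist j.1.1 x y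
  φ_side : ∀ j (x : X.Face j.1.1), (x : X.T j.1.1) ∈ X.side j.1 ↔ (φ j x : ℍ).re = 0
  φ_glue : ∀ (j k : X.Over e) (x : X.Face j.1.1) (x' : X.Face k.1.1),
    X.Glued j.1 k.1 x x' → (φ j x : ℍ) = (φ k x' : ℍ)
  r_max : IsGreatest (Set.range r) 1

namespace LocalModel

variable {σ : IdealHyperbolicMetric X} {e : X.Edge}

/-- The half-triangle `φ_j⁻¹ {z | Re z < r_j / 2}`. -/
abbrev Half (L : LocalModel σ e) (j : X.Over e) : Type u :=
  {x : X.Face j.1.1 // (L.φ j x : ℍ).re < L.r j / 2}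

/-- The identifications along `e` made by the gluing maps between the edges over `e`. -/
inductive HalfIdent (L : LocalModel σ e) : (Σ j, L.Half j) → (Σ j, L.Half j) → Prop
  | glued (j k : X.Over e) (x : L.Half j) (x' : L.Half k)
      (h : X.Glued j.1 k.1 x.1.1 x'.1.1) : HalfIdent L ⟨j, x⟩ ⟨k, x'⟩

/-- The union of the half-triangles at the edge `e`: the half-triangles, one for each `e_j`
lying over `e`, glued to each other along `e`. -/
def HalfUnion (L : LocalModel σ e) : Type u := Quot L.HalfIdent

/-- The inclusion of a half-triangle into the union. -/
def halfProj (L : LocalModel σ e) (j : X.Over e) (x : L.Half j) : L.HalfUnion :=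
  Quot.mk _ ⟨j, x⟩

/-- The length distance of the metric `σ` on the union of the half-triangles: the infimum of the
lengths of paths in the union. (The half-triangles are hyperbolically convex.) -/
noncomputable def halfEDist (L : LocalModel σ e) : L.HalfUnion → L.HalfUnion → ℝ≥0∞ :=
  gluedEDist L.halfProj (fun j x y => ENNReal.ofReal (σ.faceDist j.1.1 x.1 y.1))

end LocalModel

end IdealHyperbolicMetric

/-! The space is a book of half-triangles bound along the imaginary axis. For each `i`, `fold i`
maps it to `ℍ`, with the `i`-th half-triangle on the right and all others reflected to the left.
Taking the supremum of the distances seen by the folds gives the triangle inequality for free.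
Moreover `fold i` is exact on distances from the `i`-th half-triangle (`dist_fold_of_left`), and
`fold j` is isometric on any pair of half-triangles `j`, `k`.

Each half-triangle is cut out by half-planes, and those other than `0 ≤ re z` contain the whole left
side. Hence the image of a pair contains the hyperbolic geodesic between the two given points
(`exists_fold_eq`). This gives geodesics, and crossing points on the axis that identify the supremum
with the length distance (`edist_eq_halfEDist`).

For the comparison, `cosh_dist_eq_hyp` makes `cosh (dist z w)` a Lorentz product, and points of a
geodesic are `sinh`-weighted combinations of its ends. Folds differ only in the sign of `hypX`.
Along a geodesic `hypT` and `hypZ` therefore satisfy the linear relation exactly, while `hypX ∘ fold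
i` is concave (`sinh_mul_hypX_fold_le`). If `P` lies in the `i`-th half-triangle, its own `hypX` is
nonnegative and enters with a minus sign, so concavity becomes the required upper bound. -/

namespace UpperHalfPlane

/-! ### Hyperboloid coordinates -/

/-- The timelike coordinate of a point of `ℍ` on the hyperboloid. -/
noncomputable def hypT (z : ℍ) : ℝ := (1 + z.re ^ 2 + z.im ^ 2) / (2 * z.im)

/-- The spacelike hyperboloid coordinate that vanishes on the imaginary axis. -/
noncomputable def hypX (z : ℍ) : ℝ := z.re / z.im

/-- The spacelike hyperboloid coordinate that vanishes on the unit circle. -/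
noncomputable def hypZ (z : ℍ) : ℝ := (z.re ^ 2 + z.im ^ 2 - 1) / (2 * z.im)

theorem cosh_dist_eq_hyp (z w : ℍ) :
    Real.cosh (dist z w) = hypT z * hypT w - hypX z * hypX w - hypZ z * hypZ w := by
  have hz := z.im_pos.ne'
  have hw := w.im_pos.ne'
  have h : dist (z : ℂ) w ^ 2 = (z.re - w.re) ^ 2 + (z.im - w.im) ^ 2 := by
    rw [Complex.dist_eq, ← Complex.normSq_eq_norm_sq, Complex.normSq_apply]
    simp only [Complex.sub_re, Complex.sub_im, UpperHalfPlane.coe_re, UpperHalfPlane.coe_im]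
    ring
  rw [cosh_dist, h, hypT, hypT, hypX, hypX, hypZ, hypZ]
  field_simp
  ring

theorem hyp_norm (z : ℍ) : hypT z ^ 2 - hypX z ^ 2 - hypZ z ^ 2 = 1 := by
  have h := cosh_dist_eq_hyp z z
  rw [dist_self, Real.cosh_zero] at h
  linarith

theorem hypT_sub_hypZ (z : ℍ) : hypT z - hypZ z = 1 / z.im := by
  have hz := z.im_pos.ne'
  rw [hypT, hypZ]
  field_simp
  ring

theorem hypT_add_hypZ (z : ℍ) : hypT z + hypZ z = (z.re ^ 2 + z.im ^ 2) / z.im := by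
  have hz := z.im_pos.ne'
  rw [hypT, hypZ]
  field_simp
  ring

theorem hypT_sub_hypZ_pos (z : ℍ) : 0 < hypT z - hypZ z := by
  rw [hypT_sub_hypZ]
  exact one_div_pos.2 z.im_pos

theorem hypX_nonneg_iff (z : ℍ) : 0 ≤ hypX z ↔ 0 ≤ z.re :=
  ⟨fun h => by simpa [hypX, z.im_pos.ne'] using mul_nonneg h z.im_pos.le, fun h => div_nonneg h z.im_pos.le⟩

theorem re_eq_zero_of_hypX {z : ℍ} (h : hypX z = 0) : z.re = 0 :=
  (div_eq_zero_iff.1 h).resolve_right z.im_pos.ne'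

theorem re_lt_iff_hyp (z : ℍ) (c : ℝ) : z.re < c ↔ hypX z < c * (hypT z - hypZ z) := by
  rw [hypT_sub_hypZ, hypX, mul_one_div, div_lt_div_iff_of_pos_right z.im_pos]

theorem circle_le_iff_hyp (z : ℍ) (r : ℝ) :
    (r / 2) ^ 2 ≤ (z.re - r / 2) ^ 2 + z.im ^ 2 ↔ r * hypX z ≤ hypT z + hypZ z := by
  rw [hypT_add_hypZ, hypX, ← mul_div_assoc, div_le_div_iff_of_pos_right z.im_pos]
  constructor <;> intro h <;> nlinarith

/-- Since `t - s` is `1 / im`, its positivity selects the upper sheet, and `x / (t - s)` recovers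
the real part. -/
theorem exists_hyp_eq {t x s : ℝ} (h : t ^ 2 - x ^ 2 - s ^ 2 = 1) (hpos : 0 < t - s) :
    ∃ z : ℍ, hypT z = t ∧ hypX z = x ∧ hypZ z = s := by
  have hne := hpos.ne'
  refine ⟨⟨⟨x / (t - s), 1 / (t - s)⟩, one_div_pos.2 hpos⟩, ?_, ?_, ?_⟩
  · change (1 + (x / (t - s)) ^ 2 + (1 / (t - s)) ^ 2) / (2 * (1 / (t - s))) = t
    field_simp
    linarith
  · change x / (t - s) / (1 / (t - s)) = x
    field_simp
  · change ((x / (t - s)) ^ 2 + (1 / (t - s)) ^ 2 - 1) / (2 * (1 / (t - s))) = s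
    field_simp
    linarith

/-! ### Points on geodesics -/

/-- `m` divides the geodesic from `u` to `v` of length `a + b` at distance `b` from `u` and `a`
from `v`, expressed in hyperboloid coordinates. -/
structure DividesGeodesic (u v : ℍ) (a b : ℝ) (m : ℍ) : Prop where
  hT : Real.sinh (a + b) * hypT m = Real.sinh a * hypT u + Real.sinh b * hypT v
  hX : Real.sinh (a + b) * hypX m = Real.sinh a * hypX u + Real.sinh b * hypX v
  hZ : Real.sinh (a + b) * hypZ m = Real.sinh a * hypZ u + Real.sinh b * hypZ v

theorem exists_dividesGeodesic (u v : ℍ) {a b : ℝ} (ha : 0 ≤ a) (hb : 0 ≤ b)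
    (hab : a + b = dist u v) (hpos : 0 < a + b) : ∃ m, DividesGeodesic u v a b m := by
  have hs : 0 < Real.sinh (a + b) := Real.sinh_pos_iff.2 hpos
  have hsa : 0 ≤ Real.sinh a := Real.sinh_nonneg_iff.2 ha
  have hsb : 0 ≤ Real.sinh b := Real.sinh_nonneg_iff.2 hb
  have hne := hs.ne'
  have hc := cosh_dist_eq_hyp u v
  rw [← hab] at hc
  -- This is the Lorentz norm of the weighted sum of `u` and `v`; dividing by `sinh (a + b)` returns
  -- it to the hyperboloid.
  have key : Real.sinh a ^ 2 + Real.sinh b ^ 2 + 2 * Real.sinh a * Real.sinh b * Real.cosh (a + b)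
      = Real.sinh (a + b) ^ 2 := by
    rw [Real.sinh_add, Real.cosh_add]
    linear_combination (-Real.sinh a ^ 2) * Real.cosh_sq b - Real.sinh b ^ 2 * Real.cosh_sq a
  have hu := hyp_norm u
  have hv := hyp_norm v
  obtain ⟨m, h1, h2, h3⟩ := exists_hyp_eq
    (t := (Real.sinh a * hypT u + Real.sinh b * hypT v) / Real.sinh (a + b))
    (x := (Real.sinh a * hypX u + Real.sinh b * hypX v) / Real.sinh (a + b))
    (s := (Real.sinh a * hypZ u + Real.sinh b * hypZ v) / Real.sinh (a + b))
    (by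
      rw [div_pow, div_pow, div_pow, ← sub_div, ← sub_div, div_eq_one_iff_eq (pow_ne_zero _ hne),
        ← key]
      linear_combination Real.sinh a ^ 2 * hu + Real.sinh b ^ 2 * hv -
        2 * Real.sinh a * Real.sinh b * hc)
    (by
      rw [← sub_div]
      refine div_pos ?_ hs
      have hu' := hypT_sub_hypZ_pos u
      have hv' := hypT_sub_hypZ_pos v
      rcases ha.eq_or_lt with h | h
      · have : 0 < Real.sinh b := Real.sinh_pos_iff.2 (by linarith)
        nlinarith [mul_pos this hv', mul_nonneg hsa hu'.le]
      · have : 0 < Real.sinh a := Real.sinh_pos_iff.2 h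
        nlinarith [mul_pos this hu', mul_nonneg hsb hv'.le])
  exact ⟨m, by rw [h1]; field_simp, by rw [h2]; field_simp, by rw [h3]; field_simp⟩

theorem eq_of_cosh_dist_eq_one {z w : ℍ} (h : Real.cosh (dist z w) = 1) : z = w := by
  by_contra hne
  exact (Real.one_lt_cosh.2 (dist_pos.2 hne).ne').ne' h

theorem dist_eq_abs_of_cosh {z w : ℍ} {c : ℝ} (h : Real.cosh (dist z w) = Real.cosh c) :
    dist z w = |c| := by
  have h1 := Real.cosh_le_cosh.1 h.le
  have h2 := Real.cosh_le_cosh.1 h.ge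
  rw [abs_of_nonneg dist_nonneg] at h1 h2
  exact le_antisymm h1 h2

/-- A point at the right distances from `u` and `v` is the dividing point of the geodesic. -/
theorem dividesGeodesic_of_dist {u v m : ℍ} {a b : ℝ} (hab : a + b = dist u v)
    (hu : dist u m = b) (hv : dist m v = a) : DividesGeodesic u v a b m := by
  have ha : 0 ≤ a := hv ▸ dist_nonneg
  have hb : 0 ≤ b := hu ▸ dist_nonneg
  rcases (add_nonneg ha hb).eq_or_lt with h | h
  · have h1 : a = 0 := by linarith
    have h2 : b = 0 := by linarith
    subst h1 h2
    constructor <;> simp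
  obtain ⟨m', hT, hX, hZ⟩ := exists_dividesGeodesic u v ha hb hab h
  have hs : Real.sinh (a + b) ≠ 0 := (Real.sinh_pos_iff.2 h).ne'
  have e1 := cosh_dist_eq_hyp u m
  have e2 := cosh_dist_eq_hyp m v
  rw [hu] at e1
  rw [hv] at e2
  -- Pairing the relations for `m'` with `m` gives `sinh a * cosh b + sinh b * cosh a`, so the
  -- Lorentz product of `m` and `m'` is `1`.
  have : m = m' := by
    apply eq_of_cosh_dist_eq_one
    rw [← mul_right_inj' hs, cosh_dist_eq_hyp, mul_one]
    have := Real.sinh_add a b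
    linear_combination hypT m * hT - hypX m * hX - hypZ m * hZ - Real.sinh a * e1 -
      Real.sinh b * e2 - this
  subst this
  exact ⟨hT, hX, hZ⟩

/-- Expand the Lorentz product of the two combinations. Length zero is excluded because the defining
relations then say nothing about `m`. -/
theorem DividesGeodesic.dist_eq {u v m m' : ℍ} {a b a' b' : ℝ} (h : DividesGeodesic u v a b m)
    (h' : DividesGeodesic u v a' b' m') (hab : a + b = dist u v) (hab' : a' + b' = dist u v)
    (hpos : 0 < dist u v) : dist m m' = |b - b'| := by
  apply dist_eq_abs_of_cosh
  have hs : Real.sinh (dist u v) ≠ 0 := (Real.sinh_pos_iff.2 hpos).ne'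
  obtain ⟨hT, hX, hZ⟩ := h
  obtain ⟨hT', hX', hZ'⟩ := h'
  have hc := cosh_dist_eq_hyp u v
  rw [hab] at hT hX hZ
  rw [hab'] at hT' hX' hZ'
  obtain rfl : a = dist u v - b := by linarith
  obtain rfl : a' = dist u v - b' := by linarith
  have hu := hyp_norm u
  have hv := hyp_norm v
  set l := dist u v
  have e : Real.sinh l ^ 2 * Real.cosh (dist m m') =
      Real.sinh (l - b) * Real.sinh (l - b') + Real.sinh b * Real.sinh b' +
      (Real.sinh (l - b) * Real.sinh b' + Real.sinh b * Real.sinh (l - b')) * Real.cosh l := by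
    rw [cosh_dist_eq_hyp, hc]
    linear_combination Real.sinh l * hypT m' * hT - Real.sinh l * hypX m' * hX -
      Real.sinh l * hypZ m' * hZ +
      (Real.sinh (l - b) * hypT u + Real.sinh b * hypT v) * hT' -
      (Real.sinh (l - b) * hypX u + Real.sinh b * hypX v) * hX' -
      (Real.sinh (l - b) * hypZ u + Real.sinh b * hypZ v) * hZ' +
      Real.sinh (l - b) * Real.sinh (l - b') * hu + Real.sinh b * Real.sinh b' * hv
  rw [← mul_right_inj' (pow_ne_zero 2 hs), e]
  simp only [Real.sinh_sub, Real.cosh_sub]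
  linear_combination (Real.sinh b * Real.sinh b') *
    (-Real.cosh_sq l)

/-! ### The reflection in the imaginary axis -/

/-- The reflection of the upper half-plane in the imaginary axis. -/
def reflect (z : ℍ) : ℍ := ⟨⟨-z.re, z.im⟩, z.im_pos⟩

@[simp] theorem reflect_re (z : ℍ) : (reflect z).re = -z.re := rfl
@[simp] theorem reflect_im (z : ℍ) : (reflect z).im = z.im := rfl
@[simp] theorem hypT_reflect (z : ℍ) : hypT (reflect z) = hypT z := by simp [hypT]
@[simp] theorem hypX_reflect (z : ℍ) : hypX (reflect z) = -hypX z := by simp [hypX, neg_div]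
@[simp] theorem hypZ_reflect (z : ℍ) : hypZ (reflect z) = hypZ z := by simp [hypZ]

@[simp] theorem reflect_reflect (z : ℍ) : reflect (reflect z) = z := ext_re_im (by simp) (by simp)

theorem reflect_of_re_eq_zero {z : ℍ} (h : z.re = 0) : reflect z = z :=
  ext_re_im (by simp [h]) (by simp)

theorem dist_eq_of_cosh_eq {z w z' w' : ℍ}
    (h : Real.cosh (dist z w) = Real.cosh (dist z' w')) : dist z w = dist z' w' :=
  (dist_eq_abs_of_cosh h).trans (abs_of_nonneg dist_nonneg)

theorem dist_reflect_reflect (z w : ℍ) : dist (reflect z) (reflect w) = dist z w := by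
  apply dist_eq_of_cosh_eq
  simp [cosh_dist_eq_hyp]

theorem dist_reflect_right (z w : ℍ) : dist z (reflect w) = dist (reflect z) w := by
  rw [← dist_reflect_reflect, reflect_reflect]

theorem dist_le_dist_reflect {z w : ℍ} (hz : 0 ≤ z.re) (hw : 0 ≤ w.re) :
    dist z w ≤ dist z (reflect w) := by
  have h : Real.cosh (dist z w) ≤ Real.cosh (dist z (reflect w)) := by
    simp only [cosh_dist_eq_hyp, hypT_reflect, hypX_reflect, hypZ_reflect]
    nlinarith [mul_nonneg ((hypX_nonneg_iff z).2 hz) ((hypX_nonneg_iff w).2 hw)]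
  simpa [abs_of_nonneg dist_nonneg] using Real.cosh_le_cosh.1 h

end UpperHalfPlane

/-! ### Chain distances -/

theorem le_chainEDist {Y : Type*} [PseudoEMetricSpace Y] {c : Y → Y → ℝ≥0∞}
    (h : ∀ p q, edist p q ≤ c p q) (p q : Y) : edist p q ≤ chainEDist c p q := by
  refine le_iInf fun n => le_iInf fun w => le_iInf fun hw => ?_
  rw [← hw.1, ← hw.2]
  exact (edist_le_range_sum_edist w n).trans (Finset.sum_le_sum fun k _ => h _ _)

theorem chainEDist_le {Y : Type*} (c : Y → Y → ℝ≥0∞) (p q : Y) : chainEDist c p q ≤ c p q := by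
  refine (iInf_le_of_le 1 <| iInf_le_of_le (fun k => if k = 0 then p else q) <|
    iInf_le_of_le ⟨by simp, by simp⟩ ?_)
  simp

theorem chainEDist_le_add {Y : Type*} (c : Y → Y → ℝ≥0∞) (p m q : Y) :
    chainEDist c p q ≤ c p m + c m q := by
  refine (iInf_le_of_le 2 <|
    iInf_le_of_le (fun k => if k = 0 then p else if k = 1 then m else q) <|
    iInf_le_of_le ⟨by simp, by simp⟩ ?_)
  simp [Finset.sum_range_succ]

section

variable {ι : Type*} {P : ι → Type*} {Y : Type*} {π : ∀ i, P i → Y} {d : ∀ i, P i → P i → ℝ≥0∞}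

theorem le_gluedEDist [PseudoEMetricSpace Y]
    (h : ∀ i x y, edist (π i x) (π i y) ≤ d i x y) (p q : Y) : edist p q ≤ gluedEDist π d p q := by
  refine le_chainEDist (fun p q => ?_) p q
  refine le_iInf fun i => le_iInf fun x => le_iInf fun y => le_iInf fun hxy => ?_
  rw [← hxy.1, ← hxy.2]
  exact h i x y

theorem gluedEDist_le (i : ι) (x y : P i) : gluedEDist π d (π i x) (π i y) ≤ d i x y :=
  (chainEDist_le _ _ _).trans <|
    iInf_le_of_le i <| iInf_le_of_le x <| iInf_le_of_le y <| iInf_le_of_le ⟨rfl, rfl⟩ le_rfl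

theorem gluedEDist_le_add {i j : ι} {x x' : P i} {y' y : P j} (h : π i x' = π j y') :
    gluedEDist π d (π i x) (π j y) ≤ d i x x' + d j y' y :=
  (chainEDist_le_add _ _ (π i x') _).trans <| add_le_add
    (iInf_le_of_le i <| iInf_le_of_le x <| iInf_le_of_le x' <| iInf_le_of_le ⟨rfl, rfl⟩ le_rfl)
    (iInf_le_of_le j <| iInf_le_of_le y' <| iInf_le_of_le y <| iInf_le_of_le ⟨h.symm, rfl⟩ le_rfl)

end

/-! ### Edges of triangles -/

namespace TriangleFamily

variable (F : TriangleFamily.{u})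

theorem coord_nonneg {i : F.C} (x : F.T i) (k : Fin 3) : 0 ≤ F.coord x k := (F.param i x).2.1 k

theorem coord_add {i : F.C} (x : F.T i) (k : Fin 3) :
    F.coord x k + F.coord x (k + 1) + F.coord x (k + 2) = 1 := by
  have h : ∑ m, F.coord x m = 1 := (F.param i x).2.2
  rw [Fin.sum_univ_three] at h
  fin_cases k
  · exact h
  · change F.coord x 1 + F.coord x 2 + F.coord x 0 = 1
    linarith
  · change F.coord x 2 + F.coord x 0 + F.coord x 1 = 1
    linarith

theorem eq_or_eq_succ (k m : Fin 3) : m = k ∨ m = k + 1 ∨ m = k + 2 := by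
  revert m k
  decide

theorem ext_coord {i : F.C} {x y : F.T i} (k : Fin 3) (h0 : F.coord x k = F.coord y k)
    (h1 : F.coord x (k + 1) = F.coord y (k + 1)) : x = y := by
  have hx := F.coord_add x k
  have hy := F.coord_add y k
  have h2 : F.coord x (k + 2) = F.coord y (k + 2) := by linarith
  apply (F.param i).injective
  apply Subtype.ext
  funext m
  rcases eq_or_eq_succ k m with rfl | rfl | rfl
  exacts [h0, h1, h2]

theorem continuous_coord (i : F.C) (k : Fin 3) : Continuous fun x : F.T i => F.coord x k :=
  (continuous_apply k).comp (continuous_subtype_val.comp (F.param i).continuous)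

/-- The barycentric coordinates of the points of the edge opposite to the vertex `k`. -/
def sideVec (k : Fin 3) (s : ℝ) (m : Fin 3) : ℝ :=
  if m = k then 0 else if m = k + 1 then s else 1 - s

theorem sideVec_mem (k : Fin 3) {s : ℝ} (hs : s ∈ Set.Icc (0 : ℝ) 1) :
    sideVec k s ∈ stdSimplex ℝ (Fin 3) := by
  obtain ⟨h0, h1⟩ := hs
  constructor
  · intro m
    unfold sideVec
    split_ifs <;> linarith
  · rw [Fin.sum_univ_three]
    unfold sideVec
    fin_cases k <;> simp

/-- The affine parametrization of an edge. -/
def sidePoint (a : F.TEdge) (s : Set.Icc (0 : ℝ) 1) : F.T a.1 :=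
  (F.param a.1).symm ⟨sideVec a.2 s, sideVec_mem a.2 s.2⟩

theorem coord_sidePoint (a : F.TEdge) (s : Set.Icc (0 : ℝ) 1) (m : Fin 3) :
    F.coord (F.sidePoint a s) m = sideVec a.2 s m := by
  rw [coord, sidePoint, Homeomorph.apply_symm_apply]
  rfl

theorem sidePoint_mem (a : F.TEdge) (s : Set.Icc (0 : ℝ) 1) : F.sidePoint a s ∈ F.side a := by
  simp [side, coord_sidePoint, sideVec]

theorem coord_sidePoint_succ (a : F.TEdge) (s : Set.Icc (0 : ℝ) 1) :
    F.coord (F.sidePoint a s) (a.2 + 1) = s := by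
  simp [coord_sidePoint, sideVec]

theorem continuous_sidePoint (a : F.TEdge) : Continuous (F.sidePoint a) := by
  refine (F.param a.1).symm.continuous.comp (Continuous.subtype_mk ?_ _)
  refine continuous_pi fun m => ?_
  unfold sideVec
  split_ifs <;> fun_prop

theorem coord_succ_mem_Icc (a : F.TEdge) (x : F.T a.1) :
    F.coord x (a.2 + 1) ∈ Set.Icc (0 : ℝ) 1 := by
  have := F.coord_add x a.2
  exact ⟨F.coord_nonneg _ _, by linarith [F.coord_nonneg x a.2, F.coord_nonneg x (a.2 + 2)]⟩

theorem isVertex_iff_of_mem_side {a : F.TEdge} {x : F.T a.1} (hx : x ∈ F.side a) :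
    F.IsVertex x ↔ F.coord x (a.2 + 1) = 0 ∨ F.coord x (a.2 + 1) = 1 := by
  have h := F.coord_add x a.2
  rw [show F.coord x a.2 = 0 from hx] at h
  constructor
  · rintro ⟨m, hm⟩
    rcases eq_or_eq_succ a.2 m with rfl | rfl | rfl
    · exact absurd (hm.symm.trans hx) one_ne_zero
    · exact Or.inr hm
    · exact Or.inl (by linarith)
  · rintro (h0 | h0)
    · exact ⟨a.2 + 2, by linarith⟩
    · exact ⟨_, h0⟩

/-- A homeomorphism between edges sends interior points of the edge to interior points. -/
theorem not_isVertex_of_homeomorph {a b : F.TEdge} (f : F.side a ≃ₜ F.side b) {x : F.T a.1}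
    (hx : x ∈ F.side a) (hv : ¬ F.IsVertex x) : ¬ F.IsVertex (f ⟨x, hx⟩ : F.T b.1) := by
  rw [F.isVertex_iff_of_mem_side (f ⟨x, hx⟩).2]
  rw [F.isVertex_iff_of_mem_side hx] at hv
  -- In affine parameters `f` is a continuous injection of `[0, 1]` into itself, hence strictly
  -- monotone, so an interior parameter cannot reach an end value.
  let h : Set.Icc (0 : ℝ) 1 → ℝ := fun s =>
    F.coord (f ⟨F.sidePoint a s, F.sidePoint_mem a s⟩ : F.T b.1) (b.2 + 1)
  have hc : Continuous h := (F.continuous_coord b.1 (b.2 + 1)).comp <| continuous_subtype_val.comp <|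
    f.continuous.comp <| Continuous.subtype_mk (F.continuous_sidePoint a) _
  have hi : Function.Injective h := by
    intro s t hst
    have h1 := F.ext_coord b.2
      (((f _).2 : F.coord _ _ = 0).trans ((f _).2 : F.coord _ _ = 0).symm) hst
    have h2 := congrArg Subtype.val (f.injective (Subtype.ext h1))
    have h3 := congrArg (fun y => F.coord y (a.2 + 1)) h2
    simp only [coord_sidePoint_succ] at h3
    exact Subtype.ext h3
  let s : Set.Icc (0 : ℝ) 1 := ⟨F.coord x (a.2 + 1), F.coord_succ_mem_Icc a x⟩
  have hs : F.sidePoint a s = x := by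
    refine F.ext_coord a.2 ?_ (F.coord_sidePoint_succ a s)
    exact (F.sidePoint_mem a s : F.coord _ _ = 0).trans (hx : F.coord x _ = 0).symm
  have hhs : F.coord (f ⟨x, hx⟩ : F.T b.1) (b.2 + 1) = h s := by simp only [h, hs]
  have h01 : ∀ t, h t ∈ Set.Icc (0 : ℝ) 1 := fun t => F.coord_succ_mem_Icc b _
  have s0 : (⟨0, by simp⟩ : Set.Icc (0 : ℝ) 1) < s :=
    lt_of_le_of_ne s.2.1 fun h => hv (Or.inl (congrArg Subtype.val h).symm)
  have s1 : s < (⟨1, by simp⟩ : Set.Icc (0 : ℝ) 1) :=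
    lt_of_le_of_ne s.2.2 fun h => hv (Or.inr (congrArg Subtype.val h))
  have a0 := h01 ⟨0, by simp⟩
  have a1 := h01 ⟨1, by simp⟩
  rw [hhs]
  rcases hc.strictMono_of_inj hi with hm | hm
  · have b0 := hm s0
    have b1 := hm s1
    rintro (h | h) <;> linarith [a0.1, a1.2]
  · have b0 := hm s0
    have b1 := hm s1
    rintro (h | h) <;> linarith [a0.2, a1.1]

end TriangleFamily

/-! ### The union of the half-triangles -/

namespace IdealHyperbolicMetric.LocalModel

open UpperHalfPlane

variable {X : TriangleComplex.{u}} {σ : IdealHyperbolicMetric X} {e : X.Edge} (L : σ.LocalModel e)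

theorem exists_glued (j k : X.Over e) (x : X.Face j.1.1) (hx : (L.φ j x : ℍ).re = 0) :
    ∃ y : X.Face k.1.1, X.Glued j.1 k.1 x y := by
  have hjk : (X.glue j.1 k.1).Nonempty :=
    Quotient.exact (s := X.edgeSetoid) (j.2.trans k.2.symm)
  obtain ⟨f, hf⟩ := hjk
  have hs := (L.φ_side j x).2 hx
  exact ⟨⟨f ⟨x, hs⟩, X.not_isVertex_of_homeomorph f hs x.2⟩, f, hf, hs, rfl⟩

/-- The position of a point of a half-triangle in the upper half-plane. -/
def pos {j : X.Over e} (x : L.Half j) : ℍ := L.φ j x.1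

theorem pos_injective (j : X.Over e) : Function.Injective (L.pos (j := j)) := fun _ _ h =>
  Subtype.ext ((L.φ j).injective (Subtype.ext h))

theorem pos_re_nonneg {j : X.Over e} (x : L.Half j) : 0 ≤ (L.pos x).re := (L.φ j x.1).2.1

theorem pos_eq_of_glued {j k : X.Over e} {x : L.Half j} {y : L.Half k}
    (h : X.Glued j.1 k.1 x.1.1 y.1.1) : L.pos x = L.pos y ∧ (L.pos x).re = 0 :=
  ⟨L.φ_glue j k _ _ h, (L.φ_side j _).1 h.choose_spec.2.choose⟩

/-- Any two edges over `e` are joined by a gluing map, and the model maps are compatible with it, so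
a position on the axis determines the point of the quotient. -/
theorem halfProj_eq {j k : X.Over e} {x : L.Half j} {y : L.Half k} (h : L.pos x = L.pos y)
    (h0 : (L.pos x).re = 0) : L.halfProj j x = L.halfProj k y := by
  obtain ⟨y', hy'⟩ := L.exists_glued j k x.1 h0
  have : y' = y.1 := (L.φ k).injective (Subtype.ext ((L.φ_glue j k _ _ hy').symm.trans h))
  subst this
  exact Quot.sound ⟨j, k, x, y, hy'⟩

theorem halfProj_surjective (p : L.HalfUnion) : ∃ j x, L.halfProj j x = p := by
  obtain ⟨⟨j, x⟩, rfl⟩ := Quot.exists_rep p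
  exact ⟨j, x, rfl⟩

/-! ### Folding maps and the metric they induce -/

open Classical in
/-- The map of the union of the half-triangles to the upper half-plane that sends the `i`-th
half-triangle to the right of the imaginary axis and the others to its left. -/
noncomputable def fold (i : X.Over e) : L.HalfUnion → ℍ :=
  Quot.lift (fun s => if s.1 = i then L.pos s.2 else reflect (L.pos s.2)) <| by
    rintro _ _ ⟨j, k, x, y, h⟩
    obtain ⟨h1, h2⟩ := L.pos_eq_of_glued h
    simp only [← h1, reflect_of_re_eq_zero h2, ite_self]

theorem fold_self {i : X.Over e} (x : L.Half i) : L.fold i (L.halfProj i x) = L.pos x :=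
  if_pos rfl

theorem fold_of_ne {i j : X.Over e} (h : j ≠ i) (x : L.Half j) :
    L.fold i (L.halfProj j x) = reflect (L.pos x) :=
  if_neg h

theorem fold_injective : Function.Injective fun (p : L.HalfUnion) i => L.fold i p := by
  intro p q h
  obtain ⟨j, x, rfl⟩ := L.halfProj_surjective p
  obtain ⟨k, y, rfl⟩ := L.halfProj_surjective q
  have hj := congrFun h j
  simp only [fold_self] at hj
  by_cases hjk : k = j
  · subst hjk
    rw [fold_self] at hj
    rw [L.pos_injective k hj]
  · rw [L.fold_of_ne hjk] at hj
    have h1 := congrArg UpperHalfPlane.re hj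
    rw [reflect_re] at h1
    have h2 : (L.pos x).re = 0 := by linarith [L.pos_re_nonneg x, L.pos_re_nonneg y]
    have h3 : (L.pos y).re = 0 := by linarith
    rw [reflect_of_re_eq_zero h3] at hj
    exact L.halfProj_eq hj h2

instance : Finite (X.Over e) :=
  haveI := X.finite_C
  Subtype.finite

/-- The supremum of the hyperbolic distances seen by the maps `fold i`. -/
noncomputable instance : MetricSpace L.HalfUnion :=
  letI := Fintype.ofFinite (X.Over e)
  MetricSpace.induced (fun p i => L.fold i p) L.fold_injective inferInstance

theorem dist_fold_le (i : X.Over e) (p q : L.HalfUnion) :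
    dist (L.fold i p) (L.fold i q) ≤ dist p q :=
  letI := Fintype.ofFinite (X.Over e)
  dist_le_pi_dist (fun i => L.fold i p) (fun i => L.fold i q) i

theorem dist_le_of_fold {p q : L.HalfUnion} {c : ℝ} (hc : 0 ≤ c)
    (h : ∀ i, dist (L.fold i p) (L.fold i q) ≤ c) : dist p q ≤ c :=
  letI := Fintype.ofFinite (X.Over e)
  (dist_pi_le_iff hc).2 h

theorem dist_halfProj_self {j : X.Over e} (x y : L.Half j) :
    dist (L.halfProj j x) (L.halfProj j y) = dist (L.pos x) (L.pos y) := by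
  refine le_antisymm (L.dist_le_of_fold dist_nonneg fun i => ?_) ?_
  · by_cases h : j = i
    · subst h
      rw [fold_self, fold_self]
    · rw [L.fold_of_ne h, L.fold_of_ne h, dist_reflect_reflect]
  · rw [← L.fold_self x, ← L.fold_self y]
    exact L.dist_fold_le j _ _

/-- The folds at `j` and `k` separate the two points and see this distance; every other fold puts
both on the left, which can only shorten it. -/
theorem dist_halfProj_of_ne {j k : X.Over e} (h : j ≠ k) (x : L.Half j) (y : L.Half k) :
    dist (L.halfProj j x) (L.halfProj k y) = dist (L.pos x) (reflect (L.pos y)) := by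
  refine le_antisymm (L.dist_le_of_fold dist_nonneg fun i => ?_) ?_
  · by_cases hj : j = i
    · subst hj
      rw [L.fold_self, L.fold_of_ne h.symm]
    rw [L.fold_of_ne hj]
    by_cases hk : k = i
    · subst hk
      rw [L.fold_self, dist_reflect_right]
    · rw [L.fold_of_ne hk, dist_reflect_reflect]
      exact dist_le_dist_reflect (L.pos_re_nonneg x) (L.pos_re_nonneg y)
  · rw [← L.fold_self x, ← L.fold_of_ne h.symm y]
    exact L.dist_fold_le j _ _

/-- The map `fold i` preserves the distances from the points of the `i`-th half-triangle. -/
theorem dist_fold_of_left {i : X.Over e} (x : L.Half i) (q : L.HalfUnion) :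
    dist (L.fold i (L.halfProj i x)) (L.fold i q) = dist (L.halfProj i x) q := by
  obtain ⟨k, y, rfl⟩ := L.halfProj_surjective q
  by_cases h : k = i
  · subst h
    rw [fold_self, fold_self, dist_halfProj_self]
  · rw [fold_self, L.fold_of_ne h, L.dist_halfProj_of_ne (Ne.symm h)]

theorem dist_fold_of_right {i : X.Over e} (p : L.HalfUnion) (y : L.Half i) :
    dist (L.fold i p) (L.fold i (L.halfProj i y)) = dist p (L.halfProj i y) := by
  rw [dist_comm, dist_fold_of_left, dist_comm]

/-- The map `fold i` preserves the distances within each half-triangle. -/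
theorem dist_fold_halfProj (i : X.Over e) {k : X.Over e} (x y : L.Half k) :
    dist (L.fold i (L.halfProj k x)) (L.fold i (L.halfProj k y)) =
      dist (L.halfProj k x) (L.halfProj k y) := by
  by_cases h : k = i
  · subst h
    exact L.dist_fold_of_left _ _
  · rw [L.fold_of_ne h, L.fold_of_ne h, dist_reflect_reflect, dist_halfProj_self]

end IdealHyperbolicMetric.LocalModel

namespace UpperHalfPlane

/-! ### Half-triangles as intersections of half-planes -/

/-- The half-planes cutting out, together with `0 ≤ re z`, the half of the ideal triangle
`0, r, ∞` at the imaginary axis. -/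
def HalfRegion (r : ℝ) (z : ℍ) : Prop :=
  z.re < r / 2 ∧ (r / 2) ^ 2 ≤ (z.re - r / 2) ^ 2 + z.im ^ 2

theorem halfRegion_iff {r : ℝ} {z : ℍ} : HalfRegion r z ↔
    hypX z < r / 2 * (hypT z - hypZ z) ∧ r * hypX z ≤ hypT z + hypZ z := by
  rw [HalfRegion, re_lt_iff_hyp, circle_le_iff_hyp]

/-- This lets convexity be applied to geodesics that start across the axis, in a different
half-triangle. -/
theorem halfRegion_of_re_nonpos {r : ℝ} (hr : 0 < r) {z : ℍ} (hz : z.re ≤ 0) : HalfRegion r z :=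
  ⟨by linarith, by nlinarith [sq_nonneg z.re, sq_nonneg z.im]⟩

namespace DividesGeodesic

variable {u v m : ℍ} {a b : ℝ}

/-- Both conditions are homogeneous linear inequalities in hyperboloid coordinates, so they survive
nonnegative combinations; `0 < a + b` keeps the strict one strict. -/
theorem halfRegion (h : DividesGeodesic u v a b m) (ha : 0 ≤ a) (hb : 0 ≤ b) (hab : 0 < a + b)
    {r : ℝ} (hu : HalfRegion r u) (hv : HalfRegion r v) : HalfRegion r m := by
  rw [halfRegion_iff] at *
  obtain ⟨hT, hX, hZ⟩ := h
  have hs : 0 < Real.sinh (a + b) := Real.sinh_pos_iff.2 hab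
  have hsa : 0 ≤ Real.sinh a := Real.sinh_nonneg_iff.2 ha
  have hsb : 0 ≤ Real.sinh b := Real.sinh_nonneg_iff.2 hb
  constructor
  · have h1 := sub_pos.2 hu.1
    have h2 := sub_pos.2 hv.1
    have h3 : 0 < Real.sinh a * (r / 2 * (hypT u - hypZ u) - hypX u) +
        Real.sinh b * (r / 2 * (hypT v - hypZ v) - hypX v) := by
      rcases ha.eq_or_lt with h | h
      · have : 0 < b := by linarith
        exact add_pos_of_nonneg_of_pos (mul_nonneg hsa h1.le) (mul_pos (Real.sinh_pos_iff.2 this) h2)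
      · exact add_pos_of_pos_of_nonneg (mul_pos (Real.sinh_pos_iff.2 h) h1) (mul_nonneg hsb h2.le)
    rw [← mul_lt_mul_iff_right₀ hs]
    linear_combination h3 + hX - r / 2 * (hT - hZ)
  · rw [← mul_le_mul_iff_right₀ hs]
    linear_combination Real.sinh a * hu.2 + Real.sinh b * hv.2 + r * hX - hT - hZ

theorem re_nonneg (h : DividesGeodesic u v a b m) (ha : 0 ≤ a) (hb : 0 ≤ b) (hab : 0 < a + b)
    (hu : 0 ≤ u.re) (hv : 0 ≤ v.re) : 0 ≤ m.re := by
  rw [← hypX_nonneg_iff] at *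
  refine nonneg_of_mul_nonneg_right ?_ (Real.sinh_pos_iff.2 hab)
  rw [h.hX]
  exact add_nonneg (mul_nonneg (Real.sinh_nonneg_iff.2 ha) hu)
    (mul_nonneg (Real.sinh_nonneg_iff.2 hb) hv)

protected theorem reflect (h : DividesGeodesic u v a b m) :
    DividesGeodesic (reflect u) (reflect v) a b (reflect m) := by
  obtain ⟨hT, hX, hZ⟩ := h
  constructor
  · simpa using hT
  · simp only [hypX_reflect]
    linarith
  · simpa using hZ

end DividesGeodesic

end UpperHalfPlane

/-! ### Convexity of pairs of half-triangles and existence of geodesics -/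

namespace IdealHyperbolicMetric.LocalModel

open UpperHalfPlane

variable {X : TriangleComplex.{u}} {σ : IdealHyperbolicMetric X} {e : X.Edge} (L : σ.LocalModel e)

theorem halfRegion_pos {j : X.Over e} (x : L.Half j) : HalfRegion (L.r j) (L.pos x) :=
  ⟨x.2, (L.φ j x.1).2.2.2⟩

theorem exists_pos_eq (j : X.Over e) {z : ℍ} (h0 : 0 ≤ z.re) (hz : HalfRegion (L.r j) z) :
    ∃ x : L.Half j, L.pos x = z := by
  have hr := L.r_pos j
  have hmem : z ∈ idealTriangle (L.r j) := ⟨h0, by linarith [hz.1], hz.2⟩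
  have h : (L.φ j ((L.φ j).symm ⟨z, hmem⟩) : ℍ) = z := by rw [Equiv.apply_symm_apply]
  exact ⟨⟨(L.φ j).symm ⟨z, hmem⟩, by rw [h]; exact hz.1⟩, h⟩

/-- The union of the `j`-th and the `k`-th half-triangle. -/
def leaves (j k : X.Over e) : Set L.HalfUnion :=
  Set.range (L.halfProj j) ∪ Set.range (L.halfProj k)

/-- The map `fold j` is an isometry on the union of the `j`-th and another half-triangle. -/
theorem dist_fold_of_leaves {j k : X.Over e} {p q : L.HalfUnion} (hp : p ∈ L.leaves j k)
    (hq : q ∈ L.leaves j k) : dist (L.fold j p) (L.fold j q) = dist p q := by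
  rcases hp with ⟨x, rfl⟩ | ⟨x, rfl⟩
  · exact L.dist_fold_of_left x q
  · rcases hq with ⟨y, rfl⟩ | ⟨y, rfl⟩
    · exact L.dist_fold_of_right _ y
    · exact L.dist_fold_halfProj j x y

theorem exists_fold_eq {j k : X.Over e} (x : L.Half j) (y : L.Half k) {a b : ℝ} (ha : 0 ≤ a)
    (hb : 0 ≤ b) (hab : 0 < a + b) {m : ℍ}
    (h : DividesGeodesic (L.fold j (L.halfProj j x)) (L.fold j (L.halfProj k y)) a b m) :
    ∃ p ∈ L.leaves j k, L.fold j p = m := by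
  rw [fold_self] at h
  by_cases hkj : k = j
  · subst hkj
    rw [fold_self] at h
    obtain ⟨z, hz⟩ := L.exists_pos_eq k
      (h.re_nonneg ha hb hab (L.pos_re_nonneg x) (L.pos_re_nonneg y))
      (h.halfRegion ha hb hab (L.halfRegion_pos x) (L.halfRegion_pos y))
    exact ⟨L.halfProj k z, Or.inl ⟨z, rfl⟩, by rw [fold_self, hz]⟩
  rw [L.fold_of_ne hkj] at h
  rcases le_total 0 m.re with hm | hm
  · obtain ⟨z, hz⟩ := L.exists_pos_eq j hm (h.halfRegion ha hb hab (L.halfRegion_pos x)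
      (halfRegion_of_re_nonpos (L.r_pos j) (by simpa using L.pos_re_nonneg y)))
    exact ⟨L.halfProj j z, Or.inl ⟨z, rfl⟩, by rw [fold_self, hz]⟩
  · have h' := h.reflect
    rw [reflect_reflect] at h'
    obtain ⟨z, hz⟩ := L.exists_pos_eq k (by simpa using hm) (h'.halfRegion ha hb hab
      (halfRegion_of_re_nonpos (L.r_pos k) (by simpa using L.pos_re_nonneg x))
      (L.halfRegion_pos y))
    exact ⟨L.halfProj k z, Or.inr ⟨z, rfl⟩, by rw [L.fold_of_ne hkj, hz, reflect_reflect]⟩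

theorem exists_geodesic (p q : L.HalfUnion) : ∃ γ : ℝ → L.HalfUnion, γ 0 = p ∧ γ (dist p q) = q ∧
    ∀ s ∈ Set.Icc 0 (dist p q), ∀ t ∈ Set.Icc 0 (dist p q), dist (γ s) (γ t) = |s - t| := by
  obtain ⟨j, x, rfl⟩ := L.halfProj_surjective p
  obtain ⟨k, y, rfl⟩ := L.halfProj_surjective q
  set p := L.halfProj j x
  set q := L.halfProj k y
  rcases (dist_nonneg (x := p) (y := q)).eq_or_lt with h0 | h0
  · refine ⟨fun _ => p, rfl, dist_eq_zero.1 h0.symm, fun s hs t ht => ?_⟩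
    rw [← h0, Set.Icc_self, Set.mem_singleton_iff] at hs ht
    simp [hs, ht]
  have hp : p ∈ L.leaves j k := Or.inl ⟨x, rfl⟩
  have hq : q ∈ L.leaves j k := Or.inr ⟨y, rfl⟩
  have hd := L.dist_fold_of_leaves hp hq
  -- Outside the interval the value is the default `p`, so that `choose` yields a curve on all of
  -- `ℝ` inside the pair.
  have key : ∀ s : ℝ, ∃ m ∈ L.leaves j k, s ∈ Set.Icc 0 (dist p q) →
      DividesGeodesic (L.fold j p) (L.fold j q) (dist p q - s) s (L.fold j m) := by
    intro s
    by_cases hs : s ∈ Set.Icc 0 (dist p q)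
    · have h1 := sub_nonneg.2 hs.2
      have h2 : 0 < dist p q - s + s := by simpa using h0
      obtain ⟨m, hm⟩ := exists_dividesGeodesic (L.fold j p) (L.fold j q) h1 hs.1 (by simp [hd]) h2
      obtain ⟨m', hm', rfl⟩ := L.exists_fold_eq x y h1 hs.1 h2 hm
      exact ⟨m', hm', fun _ => hm⟩
    · exact ⟨p, hp, fun h => absurd h hs⟩
  choose γ hγ hdiv using key
  have hdist : ∀ s ∈ Set.Icc 0 (dist p q), ∀ t ∈ Set.Icc 0 (dist p q),
      dist (γ s) (γ t) = |s - t| := by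
    intro s hs t ht
    rw [← L.dist_fold_of_leaves (hγ s) (hγ t)]
    exact (hdiv s hs).dist_eq (hdiv t ht) (by simp [hd]) (by simp [hd]) (hd ▸ h0)
  -- Uniqueness of the dividing point, used for `m = p` and `m = q`, fixes the ends of the curve.
  have hend : ∀ m ∈ L.leaves j k, ∀ s ∈ Set.Icc 0 (dist p q), dist p m = s →
      dist m q = dist p q - s → γ s = m := by
    intro m hm s hs h1 h2
    rw [← dist_eq_zero, ← L.dist_fold_of_leaves (hγ s) hm]
    have := dividesGeodesic_of_dist (u := L.fold j p) (v := L.fold j q) (m := L.fold j m)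
      (a := dist p q - s) (b := s) (by simp [hd]) (by rw [L.dist_fold_of_leaves hp hm, h1])
      (by rw [L.dist_fold_of_leaves hm hq, h2])
    simpa using (hdiv s hs).dist_eq this (by simp [hd]) (by simp [hd]) (hd ▸ h0)
  exact ⟨γ, hend p hp 0 ⟨le_rfl, h0.le⟩ (by simp) (by simp),
    hend q hq _ ⟨h0.le, le_rfl⟩ rfl (by simp), hdist⟩

/-! ### The length distance -/

/-- A geodesic between two different half-triangles crosses their common edge. -/
theorem exists_dist_add_dist_eq {j k : X.Over e} (h : j ≠ k) (x : L.Half j) (y : L.Half k) :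
    ∃ (x' : L.Half j) (y' : L.Half k), L.halfProj j x' = L.halfProj k y' ∧
      dist (L.pos x) (L.pos x') + dist (L.pos y') (L.pos y) =
        dist (L.halfProj j x) (L.halfProj k y) := by
  set p := L.halfProj j x
  set q := L.halfProj k y
  have hp : p ∈ L.leaves j k := Or.inl ⟨x, rfl⟩
  have hq : q ∈ L.leaves j k := Or.inr ⟨y, rfl⟩
  have hd := L.dist_fold_of_leaves hp hq
  have hu : L.fold j p = L.pos x := L.fold_self x
  have hv : L.fold j q = reflect (L.pos y) := L.fold_of_ne h.symm y
  have hx := (hypX_nonneg_iff _).2 (L.pos_re_nonneg x)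
  have hy := (hypX_nonneg_iff _).2 (L.pos_re_nonneg y)
  obtain ⟨z, hz, hz1⟩ : ∃ z : ℍ, z.re = 0 ∧ HalfRegion (L.r j) z ∧ HalfRegion (L.r k) z ∧
      dist (L.pos x) z + dist z (reflect (L.pos y)) = dist p q := by
    rcases (dist_nonneg (x := p) (y := q)).eq_or_lt with h0 | h0
    · have hpq : L.pos x = reflect (L.pos y) := by
        rw [← hu, ← hv, ← dist_eq_zero, hd, h0]
      have : (L.pos x).re = 0 := by
        have h1 := L.pos_re_nonneg x
        have h2 := L.pos_re_nonneg y
        rw [hpq, reflect_re] at h1 ⊢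
        linarith
      refine ⟨L.pos x, this, L.halfRegion_pos x, halfRegion_of_re_nonpos (L.r_pos k) this.le, ?_⟩
      rw [← h0, hpq, dist_self, add_zero]
    · let l := dist p q
      -- Up to the factor `sinh l`, this is `hypX` at distance `s` along the folded geodesic; it
      -- changes sign, and a zero is a crossing of the axis.
      let g : ℝ → ℝ := fun s =>
        Real.sinh (l - s) * hypX (L.pos x) - Real.sinh s * hypX (L.pos y)
      have hg : ContinuousOn g (Set.Icc 0 l) := by
        have := Real.continuous_sinh
        exact Continuous.continuousOn (by fun_prop)
      have hl : 0 ≤ Real.sinh l := Real.sinh_nonneg_iff.2 h0.le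
      obtain ⟨s, hs, hgs⟩ := intermediate_value_Icc' h0.le hg (show (0 : ℝ) ∈ Set.Icc (g l) (g 0) by
        constructor
        · simpa [g] using mul_nonneg hl hy
        · simpa [g] using mul_nonneg hl hx)
      have h1 := sub_nonneg.2 hs.2
      have h2 : 0 < l - s + s := by simpa [l] using h0
      obtain ⟨m, hm⟩ := exists_dividesGeodesic (L.fold j p) (L.fold j q) h1 hs.1
        (by simp [hd]) h2
      have hm0 : m.re = 0 := by
        apply re_eq_zero_of_hypX
        refine (mul_eq_zero.1 (hm.hX.trans ?_)).resolve_left (Real.sinh_pos_iff.2 h2).ne'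
        rw [hu, hv, hypX_reflect, ← hgs]
        ring
      have e1 : DividesGeodesic (L.fold j p) (L.fold j q) l 0 (L.fold j p) :=
        dividesGeodesic_of_dist (by simp [hd, l]) (by simp) (by simp [hd, l])
      have e2 : DividesGeodesic (L.fold j p) (L.fold j q) 0 l (L.fold j q) :=
        dividesGeodesic_of_dist (by simp [hd, l]) (by simp [hd, l]) (by simp)
      refine ⟨m, hm0, halfRegion_of_re_nonpos (L.r_pos j) hm0.le,
        halfRegion_of_re_nonpos (L.r_pos k) hm0.le, ?_⟩
      have d1 := e1.dist_eq hm (by simp [hd, l]) (by simp [hd]) (hd ▸ h0)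
      have d2 := hm.dist_eq e2 (by simp [hd]) (by simp [hd, l]) (hd ▸ h0)
      rw [← hu, ← hv, d1, d2, zero_sub, abs_neg, abs_of_nonneg hs.1, abs_sub_comm,
        abs_of_nonneg h1]
      simp
  obtain ⟨x', rfl⟩ := L.exists_pos_eq j hz.ge hz1.1
  obtain ⟨y', hy'⟩ := L.exists_pos_eq k hz.ge hz1.2.1
  refine ⟨x', y', L.halfProj_eq hy'.symm hz, ?_⟩
  rw [← hz1.2.2, dist_reflect_right, reflect_of_re_eq_zero hz, hy']

theorem ofReal_faceDist {j : X.Over e} (x y : L.Half j) :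
    ENNReal.ofReal (σ.faceDist j.1.1 x.1 y.1) = ENNReal.ofReal (dist (L.pos x) (L.pos y)) := by
  rw [← L.φ_isometry]
  rfl

/-- No chain is shorter than the metric, which restricts to the hyperbolic distance on each piece;
one segment, or two meeting on the axis, attain it. -/
theorem edist_eq_halfEDist (p q : L.HalfUnion) : edist p q = L.halfEDist p q := by
  refine le_antisymm (le_gluedEDist (fun i x y => ?_) p q) ?_
  · rw [edist_dist, dist_halfProj_self, ofReal_faceDist]
  obtain ⟨j, x, rfl⟩ := L.halfProj_surjective p
  obtain ⟨k, y, rfl⟩ := L.halfProj_surjective q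
  rw [edist_dist]
  by_cases h : j = k
  · subst h
    rw [dist_halfProj_self, ← ofReal_faceDist]
    exact gluedEDist_le (π := L.halfProj) j x y
  · obtain ⟨x', y', hxy, hd⟩ := L.exists_dist_add_dist_eq h x y
    rw [← hd, ENNReal.ofReal_add dist_nonneg dist_nonneg, ← ofReal_faceDist, ← ofReal_faceDist]
    exact gluedEDist_le_add (π := L.halfProj) hxy

/-! ### The comparison inequality -/

theorem hypT_fold (i j : X.Over e) (p : L.HalfUnion) : hypT (L.fold i p) = hypT (L.fold j p) := by
  obtain ⟨k, x, rfl⟩ := L.halfProj_surjective p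
  by_cases hi : k = i <;> by_cases hj : k = j <;> (try subst hi) <;> (try subst hj) <;>
    simp [*, fold_self, fold_of_ne]

theorem hypZ_fold (i j : X.Over e) (p : L.HalfUnion) : hypZ (L.fold i p) = hypZ (L.fold j p) := by
  obtain ⟨k, x, rfl⟩ := L.halfProj_surjective p
  by_cases hi : k = i <;> by_cases hj : k = j <;> (try subst hi) <;> (try subst hj) <;>
    simp [*, fold_self, fold_of_ne]

theorem hypX_fold_le_neg {i j : X.Over e} (h : i ≠ j) (p : L.HalfUnion) :
    hypX (L.fold i p) ≤ -hypX (L.fold j p) := by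
  obtain ⟨k, x, rfl⟩ := L.halfProj_surjective p
  have hx := (hypX_nonneg_iff _).2 (L.pos_re_nonneg x)
  by_cases hi : k = i
  · subst hi
    rw [fold_self, L.fold_of_ne h, hypX_reflect, neg_neg]
  · rw [L.fold_of_ne hi, hypX_reflect]
    by_cases hj : k = j
    · subst hj
      rw [fold_self]
    · rw [L.fold_of_ne hj, hypX_reflect]
      linarith

theorem hypX_fold_le {i k : X.Over e} (h : k ≠ i) (j : X.Over e) (x : L.Half k) :
    hypX (L.fold i (L.halfProj k x)) ≤ hypX (L.fold j (L.halfProj k x)) := by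
  have hx := (hypX_nonneg_iff _).2 (L.pos_re_nonneg x)
  rw [L.fold_of_ne h, hypX_reflect]
  by_cases hj : k = j
  · subst hj
    rw [fold_self]
    linarith
  · rw [L.fold_of_ne hj, hypX_reflect]

/-- The signs are opposite if `p` lies in the `i`-th or `j`-th half-triangle; otherwise both folds
send `p` to the same point. -/
theorem neg_hypX_fold_le_or {i j : X.Over e} (h : i ≠ j) (p : L.HalfUnion) :
    hypX (L.fold i p) = -hypX (L.fold j p) ∨ hypX (L.fold i p) = hypX (L.fold j p) := by
  obtain ⟨k, x, rfl⟩ := L.halfProj_surjective p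
  by_cases hi : k = i
  · subst hi
    left
    rw [fold_self, L.fold_of_ne h, hypX_reflect, neg_neg]
  · rw [L.fold_of_ne hi, hypX_reflect]
    by_cases hj : k = j
    · subst hj
      left
      rw [fold_self]
    · right
      rw [L.fold_of_ne hj, hypX_reflect]

/-- A fold never increases distances, so if it preserves the total length it must preserve both
parts. -/
theorem dividesGeodesic_fold {l : X.Over e} {q r m : L.HalfUnion}
    (hd : dist (L.fold l q) (L.fold l r) = dist q r) (hm : dist q m + dist m r = dist q r) :
    DividesGeodesic (L.fold l q) (L.fold l r) (dist m r) (dist q m) (L.fold l m) := by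
  have h1 := L.dist_fold_le l q m
  have h2 := L.dist_fold_le l m r
  have h3 := dist_triangle (L.fold l q) (L.fold l m) (L.fold l r)
  exact dividesGeodesic_of_dist (by linarith) (by linarith) (by linarith)

/-- The signed height over the edge with respect to any half-triangle is concave along
geodesics, in the hyperbolic sense. -/
theorem sinh_mul_hypX_fold_le (i : X.Over e) {q r m : L.HalfUnion}
    (hm : dist q m + dist m r = dist q r) :
    Real.sinh (dist m r) * hypX (L.fold i q) + Real.sinh (dist q m) * hypX (L.fold i r) ≤
      Real.sinh (dist m r + dist q m) * hypX (L.fold i m) := by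
  obtain ⟨j, x, rfl⟩ := L.halfProj_surjective q
  obtain ⟨k, y, rfl⟩ := L.halfProj_surjective r
  have hj := (L.dividesGeodesic_fold (L.dist_fold_of_left x _) hm).hX
  have hk := (L.dividesGeodesic_fold (L.dist_fold_of_right _ y) hm).hX
  by_cases hij : j = i
  · subst hij
    exact hj.ge
  by_cases hik : k = i
  · subst hik
    exact hk.ge
  have ha : 0 ≤ Real.sinh (dist m (L.halfProj k y)) := Real.sinh_nonneg_iff.2 dist_nonneg
  have hb : 0 ≤ Real.sinh (dist (L.halfProj j x) m) := Real.sinh_nonneg_iff.2 dist_nonneg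
  -- Neither end is in the `i`-th half-triangle. The exact relation in `fold j` is transferred to
  -- `fold i`: equality at `m`, up to the sign in `h`, and an inequality at each end.
  rcases L.neg_hypX_fold_le_or (Ne.symm hij) m with h | h
  · rw [h, mul_neg, hj, neg_add, ← mul_neg, ← mul_neg]
    exact add_le_add (mul_le_mul_of_nonneg_left (L.hypX_fold_le_neg (Ne.symm hij) _) ha)
      (mul_le_mul_of_nonneg_left (L.hypX_fold_le_neg (Ne.symm hij) _) hb)
  · rw [h, hj]
    exact add_le_add (mul_le_mul_of_nonneg_left (L.hypX_fold_le hij _ _) ha)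
      (mul_le_mul_of_nonneg_left (L.hypX_fold_le hik _ _) hb)

theorem sinh_mul_cosh_dist_le (p q r m : L.HalfUnion) (hm : dist q m + dist m r = dist q r) :
    Real.sinh (dist q r) * Real.cosh (dist p m) ≤
      Real.sinh (dist m r) * Real.cosh (dist p q) +
        Real.sinh (dist q m) * Real.cosh (dist p r) := by
  obtain ⟨i, z, rfl⟩ := L.halfProj_surjective p
  obtain ⟨j, x, rfl⟩ := L.halfProj_surjective q
  have hdiv := L.dividesGeodesic_fold (L.dist_fold_of_left x _) hm
  have hT := hdiv.hT
  have hZ := hdiv.hZ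
  -- The division holds in the fold at `q`, but these two coordinates agree in the fold at `p`,
  -- where distances from `p` are exact.
  simp only [L.hypT_fold j i, L.hypZ_fold j i] at hT hZ
  have hX := L.sinh_mul_hypX_fold_le i hm
  have hz := (hypX_nonneg_iff _).2 (L.pos_re_nonneg z)
  rw [← L.fold_self z] at hz
  simp only [← L.dist_fold_of_left z, cosh_dist_eq_hyp]
  rw [← hm, add_comm (dist _ m)]
  linear_combination hypX (L.fold i (L.halfProj i z)) * hX + hypT (L.fold i (L.halfProj i z)) * hT
    - hypZ (L.fold i (L.halfProj i z)) * hZ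

theorem isCATNegOne_halfUnion : IsCATNegOne L.HalfUnion where
  exists_geodesic := L.exists_geodesic
  comparison p q r m t _ h1 h2 := by
    have h := L.sinh_mul_cosh_dist_le p q r m (by rw [h1, h2]; ring)
    rwa [h1, h2] at h

end IdealHyperbolicMetric.LocalModel

theorem proposition2p11 (X : TriangleComplex.{u}) (σ : IdealHyperbolicMetric X)
    (hσ : σ.IsComplete) (e : X.Edge) (L : σ.LocalModel e) :
    ∃ _ : MetricSpace L.HalfUnion,
      (∀ p q : L.HalfUnion, edist p q = L.halfEDist p q) ∧ IsCATNegOne L.HalfUnion :=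
  ⟨inferInstance, L.edist_eq_halfEDist, L.isCATNegOne_halfUnion⟩
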